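/- For real $|q|<1$ let $\varphi(q)=\sum_{n=-\infty}^{\infty}q^{n^2}$ and $\psi(q)=\sum_{n=0}^{\infty}q^{n(n+1)/2}$ be Ramanujan's theta functions, and for positive real numbers $k$ and $n$ let $$A'_{k,n}=\frac{\varphi(q)}{2k^{1/4}q^{k/4}\psi(q^{2k})},\qquad q=e^{-\pi\sqrt{n/k}}.$$ Then, with $a=\sqrt{1+\sqrt2}$, \begin{align*} A'_{4,1}&=1+\sqrt2,\\ A'_{4,2}&=1+\sqrt2+\sqrt{1+\sqrt2},\\ A'_{4,3}&=\frac{(\sqrt2+\sqrt3)(1+\sqrt3)}{\sqrt2},\\ A'_{4,4}&=\sqrt{12+8\sqrt2}+\sqrt{8+6\sqrt2},\\ A'_{4,7}&=\frac{(3+\sqrt7)(3+2\sqrt2)}{\sqrt2},\\ A'_{4,8}&=\sqrt{62+44\sqrt2+(28\sqrt2+40)a}+\sqrt{56+40\sqrt2+(36+26\sqrt2)a},\\ A'_{4,9}&=\sqrt{108+62\sqrt3+44\sqrt6+76\sqrt2}+\sqrt{93+66\sqrt2+38\sqrt6+54\sqrt3},\\ A'_{4,12}&=\sqrt2+\sqrt{402+232\sqrt3+284\sqrt2+164\sqrt6}+\sqrt{416+240\sqrt3+294\sqrt2+170\sqrt6},\\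 A'_{4,28}&=\sqrt2+\sqrt2\,\sqrt{64641+17276\sqrt{14}+24432\sqrt7+45708\sqrt2}+2\sqrt{32384+22899\sqrt2+12240\sqrt7+8655\sqrt{14}}. \end{align*} -/

import Mathlib

open Real

noncomputable section

/-- Ramanujan's theta function `φ(q) = ∑_{n ∈ ℤ} q^{n²}`, for real `q` with `|q| < 1`. -/
def ramanujanPhi (q : ℝ) : ℝ := ∑' n : ℤ, q ^ (n ^ 2)

/-- Ramanujan's theta function `ψ(q) = ∑_{n ≥ 0} q^{n(n+1)/2}`, for real `q` with `|q| < 1`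
(the natural-number division is exact, `n (n + 1)` being even). -/
def ramanujanPsi (q : ℝ) : ℝ := ∑' n : ℕ, q ^ (n * (n + 1) / 2)

/-- The nome `q = e^{-π √(n/k)}` attached to positive real numbers `k` and `n`. -/
def thetaNome (k n : ℝ) : ℝ := Real.exp (-π * √(n / k))

/-- The parameter `A'_{k,n} = φ(q) / (2 k^{1/4} q^{k/4} ψ(q^{2k}))` with `q = e^{-π √(n/k)}`,
for positive real numbers `k` and `n`. -/
def thetaParamA' (k n : ℝ) : ℝ :=
  ramanujanPhi (thetaNome k n) /
    (2 * k ^ (1 / 4 : ℝ) * thetaNome k n ^ (k / 4) * ramanujanPsi (thetaNome k n ^ (2 * k)))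

end

/-! The odd-index terms of `φ(q)` sum to `2qψ(q⁸)`, so `φ(q) - φ(-q) = 4qψ(q⁸)` and `A'_{4,n} = √2 /
(1 - x(√n/2))`, where `x(t) = φ(-q)/φ(q)` at `q = e^{-πt}` (`thetaParamA'_four`). Everything reduces
to evaluating `x = phiRatio`, the square root of the complementary modulus `k'`.

Four relations suffice: Jacobi's `x(t)⁴ + x(1/t)⁴ = 1`, Landen's relation between `x(t)` and
`x(2t)`, and the modular equations of degrees 3 and 7 for the pairs `t, 3t` and `t, 7t`. Where
multiplication by the degree inverts `t`, as at `t = 1/√3`, the modular equation and Jacobi's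
identity together determine the value. Landen then halves the argument, and `n = 9` comes from
degree 3 at `t = 1/2`.

The theta identities behind these relations are proved by summing `q^{a² + d b²}` over congruence
classes of `(a, b)` and reparametrizing each class by a linear map that multiplies the form by a
constant. Poisson summation (`phiExp_inv`) supplies `t ↦ 1/t`. Bounds on `x` select the right
algebraic root. -/

/-! ### Summability and sums over congruence classes of lattice points -/

theorem summable_zpow_of_natAbs_le {q : ℝ} (h0 : 0 < q) (h1 : q < 1) {u : ℤ → ℤ}
    (hu : ∀ n, |n| ≤ u n + 1) : Summable fun n : ℤ => q ^ u n := by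
  have hle : ∀ n : ℤ, q ^ u n ≤ q⁻¹ * q ^ n.natAbs := by
    intro n
    have : q⁻¹ * q ^ n.natAbs = q ^ (|n| - 1) := by
      rw [zpow_sub_one₀ h0.ne', Int.abs_eq_natAbs, zpow_natCast, mul_comm]
    rw [this]
    exact zpow_le_zpow_right_of_le_one₀ h0 h1.le (by linarith [hu n])
  refine Summable.of_nonneg_of_le (fun n => (zpow_pos h0 _).le) hle (Summable.mul_left _ ?_)
  have := summable_geometric_of_lt_one h0.le h1
  refine Summable.of_nat_of_neg ?_ ?_ <;> simpa using this

theorem abs_le_sq (n : ℤ) : |n| ≤ n ^ 2 := by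
  rw [← sq_abs]
  nlinarith [abs_nonneg n, Int.le_self_sq |n|]

theorem summable_zpow_sq {q : ℝ} (h0 : 0 < q) (h1 : q < 1) {k : ℤ} (hk : 0 < k) :
    Summable fun n : ℤ => q ^ (k * n ^ 2) :=
  summable_zpow_of_natAbs_le h0 h1 fun n => by nlinarith [abs_le_sq n, sq_nonneg n]

theorem summable_zpow_odd_sq {q : ℝ} (h0 : 0 < q) (h1 : q < 1) {k : ℤ} (hk : 0 < k) :
    Summable fun n : ℤ => q ^ (k * (2 * n + 1) ^ 2) :=
  summable_zpow_of_natAbs_le h0 h1 fun n => by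
    have h : |n| ≤ (2 * n + 1) ^ 2 := by
      rcases abs_cases n with ⟨h, _⟩ | ⟨h, _⟩ <;> rw [h] <;> nlinarith
    nlinarith [sq_nonneg (2 * n + 1)]

/-- The part of the series `ramanujanPhi q` with odd indices. -/
noncomputable def oddPhi (q : ℝ) : ℝ := ∑' n : ℤ, q ^ ((2 * n + 1) ^ 2)

theorem ramanujanPhi_pow (q : ℝ) (k : ℕ) :
    ramanujanPhi (q ^ k) = ∑' n : ℤ, q ^ ((k : ℤ) * n ^ 2) := by
  simp only [ramanujanPhi, zpow_mul, zpow_natCast]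

theorem oddPhi_pow (q : ℝ) (k : ℕ) :
    oddPhi (q ^ k) = ∑' n : ℤ, q ^ ((k : ℤ) * (2 * n + 1) ^ 2) := by
  simp only [oddPhi, zpow_mul, zpow_natCast]

/-- The sum of `q ^ (a ^ 2 + d * b ^ 2)` over the pairs `(a, b)` in a set of integer points. -/
noncomputable def latticeSum (q : ℝ) (d : ℤ) (s : Set (ℤ × ℤ)) : ℝ :=
  ∑' p : s, q ^ ((p : ℤ × ℤ).1 ^ 2 + d * (p : ℤ × ℤ).2 ^ 2)

theorem summable_lattice {q : ℝ} (h0 : 0 < q) (h1 : q < 1) {d : ℤ} (hd : 0 < d) :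
    Summable fun p : ℤ × ℤ => q ^ (p.1 ^ 2 + d * p.2 ^ 2) := by
  have h := (summable_zpow_sq h0 h1 one_pos).mul_of_nonneg (summable_zpow_sq h0 h1 hd)
    (fun n => (zpow_pos h0 _).le) (fun n => (zpow_pos h0 _).le)
  simpa [zpow_add₀ h0.ne'] using h

theorem latticeSum_union {q : ℝ} (h0 : 0 < q) (h1 : q < 1) {d : ℤ} (hd : 0 < d)
    {s t u : Set (ℤ × ℤ)} (hu : u = s ∪ t) (hst : Disjoint s t) :
    latticeSum q d u = latticeSum q d s + latticeSum q d t := by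
  subst hu
  exact Summable.tsum_union_disjoint (f := fun p : ℤ × ℤ => q ^ (p.1 ^ 2 + d * p.2 ^ 2)) hst
    ((summable_lattice h0 h1 hd).subtype s) ((summable_lattice h0 h1 hd).subtype t)

theorem latticeSum_range (q : ℝ) (d : ℤ) {g : ℤ × ℤ → ℤ × ℤ} (hg : g.Injective)
    {s : Set (ℤ × ℤ)} (hs : ∀ p, p ∈ s ↔ ∃ r, g r = p) :
    latticeSum q d s = ∑' p : ℤ × ℤ, q ^ ((g p).1 ^ 2 + d * (g p).2 ^ 2) := by
  have : s = Set.range g := Set.ext hs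
  subst this
  exact tsum_range (fun p : ℤ × ℤ => q ^ (p.1 ^ 2 + d * p.2 ^ 2)) hg

/-- A linear substitution that diagonalizes the form on the class splits the double series into two
theta series; every product below arises this way. -/
theorem latticeSum_eq_mul {q : ℝ} (h0 : 0 < q) (d : ℤ) {g : ℤ × ℤ → ℤ × ℤ}
    (hg : g.Injective) {s : Set (ℤ × ℤ)} (hs : ∀ p, p ∈ s ↔ ∃ r, g r = p) {u v : ℤ → ℤ}
    (hu : Summable fun n => q ^ u n) (hv : Summable fun n => q ^ v n)
    (h : ∀ m n, (g (m, n)).1 ^ 2 + d * (g (m, n)).2 ^ 2 = u m + v n) :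
    latticeSum q d s = (∑' n, q ^ u n) * ∑' n, q ^ v n := by
  rw [latticeSum_range q d hg hs, hu.tsum_mul_tsum hv]
  · refine tsum_congr fun p => ?_
    rw [← zpow_add₀ h0.ne', ← h]
  · exact hu.mul_of_nonneg hv (fun n => (zpow_pos h0 _).le) (fun n => (zpow_pos h0 _).le)

theorem latticeSum_even_even {q : ℝ} (h0 : 0 < q) (h1 : q < 1) {d : ℕ} (hd : 0 < d) :
    latticeSum q d {p | p.1 % 2 = 0 ∧ p.2 % 2 = 0} =
      ramanujanPhi (q ^ 4) * ramanujanPhi (q ^ (4 * d)) := by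
  rw [ramanujanPhi_pow, ramanujanPhi_pow]
  refine latticeSum_eq_mul h0 d (g := fun p => (2 * p.1, 2 * p.2)) ?_ ?_
    (summable_zpow_sq h0 h1 (by norm_num)) (summable_zpow_sq h0 h1 (by positivity)) ?_
  · rintro ⟨a, b⟩ ⟨c, e⟩ h
    simp only [Prod.mk.injEq] at h ⊢
    omega
  · rintro ⟨a, b⟩
    simp only [Set.mem_ofPred_eq, Prod.exists, Prod.mk.injEq]
    exact ⟨fun _ => ⟨a / 2, b / 2, by omega, by omega⟩, by rintro ⟨m, n, h, h'⟩; omega⟩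
  · intro m n
    push_cast
    ring

theorem latticeSum_odd_odd {q : ℝ} (h0 : 0 < q) (h1 : q < 1) {d : ℕ} (hd : 0 < d) :
    latticeSum q d {p | p.1 % 2 = 1 ∧ p.2 % 2 = 1} = oddPhi q * oddPhi (q ^ d) := by
  have := oddPhi_pow q 1
  rw [pow_one] at this
  rw [this, oddPhi_pow]
  refine latticeSum_eq_mul h0 d (g := fun p => (2 * p.1 + 1, 2 * p.2 + 1)) ?_ ?_
    (summable_zpow_odd_sq h0 h1 (by norm_num)) (summable_zpow_odd_sq h0 h1 (by positivity)) ?_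
  · rintro ⟨a, b⟩ ⟨c, e⟩ h
    simp only [Prod.mk.injEq] at h ⊢
    omega
  · rintro ⟨a, b⟩
    simp only [Set.mem_ofPred_eq, Prod.exists, Prod.mk.injEq]
    exact ⟨fun _ => ⟨a / 2, b / 2, by omega, by omega⟩, by rintro ⟨m, n, h, h'⟩; omega⟩
  · intro m n
    push_cast
    ring

theorem latticeSum_neg_snd (q : ℝ) (d : ℤ) {s t : Set (ℤ × ℤ)}
    (h : ∀ a b, (a, b) ∈ t ↔ (a, -b) ∈ s) : latticeSum q d t = latticeSum q d s := by
  let e : t ≃ s := (Equiv.prodCongr (Equiv.refl ℤ) (Equiv.neg ℤ)).subtypeEquiv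
    fun p => h p.1 p.2
  refine (e.tsum_eq fun p : s => q ^ ((p : ℤ × ℤ).1 ^ 2 + d * (p : ℤ × ℤ).2 ^ 2)).symm.trans ?_ |>.symm
  refine tsum_congr fun p => ?_
  change q ^ ((p : ℤ × ℤ).1 ^ 2 + d * (-(p : ℤ × ℤ).2) ^ 2) = _
  rw [neg_sq]

/-! ### Theta identities of degrees two, three and seven -/

/-- `φ(q) = φ(q⁴) + ∑ q^{(2n+1)²}`. -/
theorem ramanujanPhi_eq_add_oddPhi {q : ℝ} (h0 : 0 < q) (h1 : q < 1) :
    ramanujanPhi q = ramanujanPhi (q ^ 4) + oddPhi q := by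
  have h := summable_zpow_sq h0 h1 one_pos
  simp only [one_mul] at h
  have he : (∑' n : ℤ, q ^ ((2 * n) ^ 2)) = ramanujanPhi (q ^ 4) := by
    rw [ramanujanPhi_pow]
    refine tsum_congr fun n => ?_
    congr 1
    push_cast
    ring
  have hev : ∑' n : Set.range (fun n : ℤ => 2 * n), q ^ ((n : ℤ) ^ 2) = ramanujanPhi (q ^ 4) :=
    (tsum_range (fun n : ℤ => q ^ (n ^ 2)) (g := fun n : ℤ => 2 * n)
      (fun a b h => by simpa using h)).trans he
  have hod : ∑' n : Set.range (fun n : ℤ => 2 * n + 1), q ^ ((n : ℤ) ^ 2) = oddPhi q :=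
    tsum_range (fun n : ℤ => q ^ (n ^ 2)) (g := fun n : ℤ => 2 * n + 1)
      (fun a b h => by simpa using h)
  have hc : (Set.range fun n : ℤ => 2 * n + 1) = (Set.range fun n : ℤ => 2 * n)ᶜ := by
    ext n
    simp only [Set.mem_range, Set.mem_compl_iff]
    exact ⟨fun ⟨m, hm⟩ ⟨k, hk⟩ => by omega,
      fun hn => ⟨n / 2, by by_contra h'; exact hn ⟨n / 2, by omega⟩⟩⟩
  rw [← hev, ← hod, hc, Summable.tsum_subtype_add_tsum_subtype_compl h]
  rfl

/-- `φ(q²)² = φ(q⁴)² + (φ(q) - φ(q⁴))²`. -/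
theorem ramanujanPhi_sq_sq {q : ℝ} (h0 : 0 < q) (h1 : q < 1) :
    ramanujanPhi (q ^ 2) ^ 2 = ramanujanPhi (q ^ 4) ^ 2 + oddPhi q ^ 2 := by
  have he := latticeSum_even_even h0 h1 one_pos
  have ho := latticeSum_odd_odd h0 h1 one_pos
  -- Pairs with even coordinate sum are the square lattice rotated by 45° and scaled by `√2`.
  have ha : latticeSum q (1 : ℕ) {p | (p.1 + p.2) % 2 = 0} =
      ramanujanPhi (q ^ 2) * ramanujanPhi (q ^ 2) := by
    rw [ramanujanPhi_pow]
    refine latticeSum_eq_mul h0 _ (g := fun p => (p.1 + p.2, p.1 - p.2)) ?_ ?_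
      (summable_zpow_sq h0 h1 (by norm_num)) (summable_zpow_sq h0 h1 (by norm_num)) ?_
    · rintro ⟨a, b⟩ ⟨c, e⟩ h
      simp only [Prod.mk.injEq] at h ⊢
      omega
    · rintro ⟨a, b⟩
      simp only [Set.mem_ofPred_eq, Prod.exists, Prod.mk.injEq]
      exact ⟨fun _ => ⟨(a + b) / 2, (a - b) / 2, by omega, by omega⟩,
        by rintro ⟨m, n, h, h'⟩; omega⟩
    · intro m n
      push_cast
      ring
  have hu := latticeSum_union h0 h1 (d := (1 : ℕ)) (by norm_num)
    (s := {p | p.1 % 2 = 0 ∧ p.2 % 2 = 0}) (t := {p | p.1 % 2 = 1 ∧ p.2 % 2 = 1})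
    (u := {p | (p.1 + p.2) % 2 = 0})
    (by ext p; simp only [Set.mem_ofPred_eq, Set.mem_union]; omega)
    (by rw [Set.disjoint_left]; intro p; simp only [Set.mem_ofPred_eq]; omega)
  rw [he, ho, ha] at hu
  simp only [mul_one, pow_one] at hu
  linarith

/-- The degree three identity, in the form
`θ₂(q⁴)θ₂(q¹²) = θ₃(q⁴)θ₃(q¹²) - θ₄(q⁴)θ₄(q¹²)`. -/
theorem oddPhi_mul_oddPhi_cube {q : ℝ} (h0 : 0 < q) (h1 : q < 1) :
    oddPhi q * oddPhi (q ^ 3) = 2 * (ramanujanPhi (q ^ 16) * oddPhi (q ^ 12) +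
      oddPhi (q ^ 4) * ramanujanPhi (q ^ 48)) := by
  have ho := latticeSum_odd_odd h0 h1 (d := 3) (by norm_num)
  -- The substitution is, up to conjugation, multiplication by `1 - √-3`, of norm 4. An odd pair has
  -- `a ≡ b` or `a ≡ -b` mod 4; the two halves have equal sums, which gives the factor 2.
  have ha : latticeSum q (3 : ℕ) {p | p.2 % 2 = 1 ∧ (p.1 - p.2) % 8 = 4} =
      ramanujanPhi (q ^ 16) * oddPhi (q ^ 12) := by
    rw [ramanujanPhi_pow, oddPhi_pow]
    refine latticeSum_eq_mul h0 _
      (g := fun p => (2 * p.1 + 3 * (2 * p.2 + 1), 2 * p.1 - (2 * p.2 + 1))) ?_ ?_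
      (summable_zpow_sq h0 h1 (by norm_num)) (summable_zpow_odd_sq h0 h1 (by norm_num)) ?_
    · rintro ⟨a, b⟩ ⟨c, e⟩ h
      simp only [Prod.mk.injEq] at h ⊢
      omega
    · rintro ⟨a, b⟩
      simp only [Set.mem_ofPred_eq, Prod.exists, Prod.mk.injEq]
      exact ⟨fun _ => ⟨(b + (a - b) / 4) / 2, (a - b) / 8, by omega, by omega⟩,
        by rintro ⟨m, n, h, h'⟩; omega⟩
    · intro m n
      push_cast
      ring
  have hb : latticeSum q (3 : ℕ) {p | p.2 % 2 = 1 ∧ (p.1 - p.2) % 8 = 0} =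
      oddPhi (q ^ 4) * ramanujanPhi (q ^ 48) := by
    rw [ramanujanPhi_pow, oddPhi_pow]
    refine latticeSum_eq_mul h0 _
      (g := fun p => ((2 * p.1 + 1) + 3 * (2 * p.2), (2 * p.1 + 1) - 2 * p.2)) ?_ ?_
      (summable_zpow_odd_sq h0 h1 (by norm_num)) (summable_zpow_sq h0 h1 (by norm_num)) ?_
    · rintro ⟨a, b⟩ ⟨c, e⟩ h
      simp only [Prod.mk.injEq] at h ⊢
      omega
    · rintro ⟨a, b⟩
      simp only [Set.mem_ofPred_eq, Prod.exists, Prod.mk.injEq]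
      exact ⟨fun _ => ⟨(b + (a - b) / 4) / 2, (a - b) / 8, by omega, by omega⟩,
        by rintro ⟨m, n, h, h'⟩; omega⟩
    · intro m n
      push_cast
      ring
  have hab := latticeSum_union h0 h1 (d := (3 : ℕ)) (by norm_num)
    (s := {p | p.2 % 2 = 1 ∧ (p.1 - p.2) % 8 = 4})
    (t := {p | p.2 % 2 = 1 ∧ (p.1 - p.2) % 8 = 0})
    (u := {p | p.2 % 2 = 1 ∧ (p.1 - p.2) % 4 = 0})
    (by ext p; simp only [Set.mem_ofPred_eq, Set.mem_union]; omega)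
    (by rw [Set.disjoint_left]; intro p; simp only [Set.mem_ofPred_eq]; omega)
  have hneg := latticeSum_neg_snd q (3 : ℕ) (s := {p | p.2 % 2 = 1 ∧ (p.1 - p.2) % 4 = 0})
    (t := {p | p.2 % 2 = 1 ∧ (p.1 + p.2) % 4 = 0})
    (by intro a b; simp only [Set.mem_ofPred_eq]; omega)
  have hu := latticeSum_union h0 h1 (d := (3 : ℕ)) (by norm_num)
    (s := {p | p.2 % 2 = 1 ∧ (p.1 - p.2) % 4 = 0})
    (t := {p | p.2 % 2 = 1 ∧ (p.1 + p.2) % 4 = 0})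
    (u := {p | p.1 % 2 = 1 ∧ p.2 % 2 = 1})
    (by ext p; simp only [Set.mem_ofPred_eq, Set.mem_union]; omega)
    (by rw [Set.disjoint_left]; intro p; simp only [Set.mem_ofPred_eq]; omega)
  rw [← ho, hu, hneg, hab, ha, hb]
  ring

/-- The degree seven identity, in the form
`2 θ₃(q⁸)θ₃(q⁵⁶) = θ₂(q⁴)θ₂(q²⁸) + 2 θ₄(q¹⁶)θ₄(q¹¹²)`. -/
theorem ramanujanPhi_mul_ramanujanPhi_seven {q : ℝ} (h0 : 0 < q) (h1 : q < 1) :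
    2 * (ramanujanPhi (q ^ 8) * ramanujanPhi (q ^ 56)) = oddPhi q * oddPhi (q ^ 7) +
      2 * ((ramanujanPhi (q ^ 64) - oddPhi (q ^ 16)) *
        (ramanujanPhi (q ^ 448) - oddPhi (q ^ 112))) := by
  have h7 : (0 : ℤ) < (7 : ℕ) := by norm_num
  have ho := latticeSum_odd_odd h0 h1 (d := 7) (by norm_num)
  -- Multiplication by `1 + √-7`, of norm 8, maps onto the class `a ≡ b` mod 8.
  have hP : latticeSum q (7 : ℕ) {p | (p.1 - p.2) % 8 = 0} =
      ramanujanPhi (q ^ 8) * ramanujanPhi (q ^ 56) := by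
    rw [ramanujanPhi_pow, ramanujanPhi_pow]
    refine latticeSum_eq_mul h0 _ (g := fun p => (p.1 - 7 * p.2, p.1 + p.2)) ?_ ?_
      (summable_zpow_sq h0 h1 (by norm_num)) (summable_zpow_sq h0 h1 (by norm_num)) ?_
    · rintro ⟨a, b⟩ ⟨c, e⟩ h
      simp only [Prod.mk.injEq] at h ⊢
      omega
    · rintro ⟨a, b⟩
      simp only [Set.mem_ofPred_eq, Prod.exists, Prod.mk.injEq]
      exact ⟨fun _ => ⟨b + (a - b) / 8, -((a - b) / 8), by omega, by omega⟩,
        by rintro ⟨m, n, h, h'⟩; omega⟩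
    · intro m n
      push_cast
      ring
  have hquad : ∀ (i j : ℤ) (u v : ℤ → ℤ), (i = 0 ∨ i = 1) → (j = 0 ∨ j = 1) →
      (∀ m, u m = 16 * (2 * m + i) ^ 2) → (∀ m, v m = 112 * (2 * m + j) ^ 2) →
      (Summable fun n => q ^ u n) → (Summable fun n => q ^ v n) →
      latticeSum q (7 : ℕ) {p | p.1 % 8 = 4 * i ∧ p.2 % 8 = 4 * j} =
        (∑' n, q ^ u n) * ∑' n, q ^ v n := by
    intro i j u v hi hj hu hv hsu hsv
    refine latticeSum_eq_mul h0 _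
      (g := fun p => (4 * (2 * p.1 + i), 4 * (2 * p.2 + j))) ?_ ?_ hsu hsv ?_
    · rintro ⟨a, b⟩ ⟨c, e⟩ h
      simp only [Prod.mk.injEq] at h ⊢
      omega
    · rintro ⟨a, b⟩
      simp only [Set.mem_ofPred_eq, Prod.exists, Prod.mk.injEq]
      exact ⟨fun _ => ⟨a / 8, b / 8, by omega, by omega⟩,
        by rintro ⟨m, n, h, h'⟩; omega⟩
    · intro m n
      rw [hu, hv]
      push_cast
      ring
  have h00 : latticeSum q (7 : ℕ) {p | p.1 % 8 = 4 * 0 ∧ p.2 % 8 = 4 * 0} =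
      ramanujanPhi (q ^ 64) * ramanujanPhi (q ^ 448) := by
    rw [ramanujanPhi_pow, ramanujanPhi_pow]
    exact hquad 0 0 _ _ (by simp) (by simp) (fun m => by push_cast; ring)
      (fun m => by push_cast; ring) (summable_zpow_sq h0 h1 (by norm_num))
      (summable_zpow_sq h0 h1 (by norm_num))
  have h01 : latticeSum q (7 : ℕ) {p | p.1 % 8 = 4 * 0 ∧ p.2 % 8 = 4 * 1} =
      ramanujanPhi (q ^ 64) * oddPhi (q ^ 112) := by
    rw [ramanujanPhi_pow, oddPhi_pow]
    exact hquad 0 1 _ _ (by simp) (by simp) (fun m => by push_cast; ring)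
      (fun m => by push_cast; ring) (summable_zpow_sq h0 h1 (by norm_num))
      (summable_zpow_odd_sq h0 h1 (by norm_num))
  have h10 : latticeSum q (7 : ℕ) {p | p.1 % 8 = 4 * 1 ∧ p.2 % 8 = 4 * 0} =
      oddPhi (q ^ 16) * ramanujanPhi (q ^ 448) := by
    rw [ramanujanPhi_pow, oddPhi_pow]
    exact hquad 1 0 _ _ (by simp) (by simp) (fun m => by push_cast; ring)
      (fun m => by push_cast; ring) (summable_zpow_odd_sq h0 h1 (by norm_num))
      (summable_zpow_sq h0 h1 (by norm_num))
  have h11 : latticeSum q (7 : ℕ) {p | p.1 % 8 = 4 * 1 ∧ p.2 % 8 = 4 * 1} =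
      oddPhi (q ^ 16) * oddPhi (q ^ 112) := by
    rw [oddPhi_pow, oddPhi_pow]
    exact hquad 1 1 _ _ (by simp) (by simp) (fun m => by push_cast; ring)
      (fun m => by push_cast; ring) (summable_zpow_odd_sq h0 h1 (by norm_num))
      (summable_zpow_odd_sq h0 h1 (by norm_num))
  -- Both parametrizations give `8X² + 8XY + 16Y²` with `X`, `Y` odd. The underlying isometry is
  -- conjugation followed by multiplication by `(-3 + √-7)/4`, of norm 1.
  have hrot : latticeSum q (7 : ℕ) {p | p.2 % 2 = 1 ∧ (p.1 - p.2) % 8 = 4} =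
      latticeSum q (7 : ℕ) {p | p.1 % 2 = 0 ∧ (p.1 - p.2) % 8 = 4} := by
    rw [latticeSum_range q _
      (g := fun p => ((2 * p.1 + 1) + 4 * (2 * p.2 + 1), 2 * p.1 + 1)),
      latticeSum_range q _
      (g := fun p => ((2 * p.1 + 1) - 3 * (2 * p.2 + 1), (2 * p.1 + 1) + (2 * p.2 + 1)))]
    · refine tsum_congr fun p => ?_
      congr 1
      push_cast
      ring
    · rintro ⟨a, b⟩ ⟨c, e⟩ h
      simp only [Prod.mk.injEq] at h ⊢
      omega
    · rintro ⟨a, b⟩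
      simp only [Set.mem_ofPred_eq, Prod.exists, Prod.mk.injEq]
      exact ⟨fun _ => ⟨(b + (a - b) / 4) / 2, -((a - b) / 8) - 1, by omega, by omega⟩,
        by rintro ⟨m, n, h, h'⟩; omega⟩
    · rintro ⟨a, b⟩ ⟨c, e⟩ h
      simp only [Prod.mk.injEq] at h ⊢
      omega
    · rintro ⟨a, b⟩
      simp only [Set.mem_ofPred_eq, Prod.exists, Prod.mk.injEq]
      exact ⟨fun _ => ⟨b / 2, (a - b) / 8, by omega, by omega⟩,
        by rintro ⟨m, n, h, h'⟩; omega⟩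
  have hneg := latticeSum_neg_snd q (7 : ℕ) (s := {p | p.2 % 2 = 1 ∧ (p.1 - p.2) % 4 = 0})
    (t := {p | p.2 % 2 = 1 ∧ (p.1 + p.2) % 4 = 0})
    (by intro a b; simp only [Set.mem_ofPred_eq]; omega)
  -- For `a ≡ 2` mod 4 the classes `a - b ≡ 0` and `a - b ≡ 4` mod 8 cancel, so only multiples of 4
  -- survive in the difference, with the signs of `φ(-q¹⁶)φ(-q¹¹²)`.
  have hneg' := latticeSum_neg_snd q (7 : ℕ) (s := {p | p.1 % 4 = 2 ∧ (p.1 - p.2) % 8 = 0})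
    (t := {p | p.1 % 4 = 2 ∧ (p.1 - p.2) % 8 = 4})
    (by intro a b; simp only [Set.mem_ofPred_eq]; omega)
  have hodd := latticeSum_union h0 h1 h7
    (s := {p | p.2 % 2 = 1 ∧ (p.1 - p.2) % 4 = 0})
    (t := {p | p.2 % 2 = 1 ∧ (p.1 + p.2) % 4 = 0})
    (u := {p | p.1 % 2 = 1 ∧ p.2 % 2 = 1})
    (by ext p; simp only [Set.mem_ofPred_eq, Set.mem_union]; omega)
    (by rw [Set.disjoint_left]; intro p; simp only [Set.mem_ofPred_eq]; omega)
  have hodd' := latticeSum_union h0 h1 h7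
    (s := {p | p.2 % 2 = 1 ∧ (p.1 - p.2) % 8 = 0})
    (t := {p | p.2 % 2 = 1 ∧ (p.1 - p.2) % 8 = 4})
    (u := {p | p.2 % 2 = 1 ∧ (p.1 - p.2) % 4 = 0})
    (by ext p; simp only [Set.mem_ofPred_eq, Set.mem_union]; omega)
    (by rw [Set.disjoint_left]; intro p; simp only [Set.mem_ofPred_eq]; omega)
  have hsplit := latticeSum_union h0 h1 h7
    (s := {p | p.2 % 2 = 1 ∧ (p.1 - p.2) % 8 = 0})
    (t := {p | p.1 % 2 = 0 ∧ (p.1 - p.2) % 8 = 0})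
    (u := {p | (p.1 - p.2) % 8 = 0})
    (by ext p; simp only [Set.mem_ofPred_eq, Set.mem_union]; omega)
    (by rw [Set.disjoint_left]; intro p; simp only [Set.mem_ofPred_eq]; omega)
  have heven0 := latticeSum_union h0 h1 h7
    (s := {p | p.1 % 4 = 2 ∧ (p.1 - p.2) % 8 = 0})
    (t := {p | p.1 % 4 = 0 ∧ (p.1 - p.2) % 8 = 0})
    (u := {p | p.1 % 2 = 0 ∧ (p.1 - p.2) % 8 = 0})
    (by ext p; simp only [Set.mem_ofPred_eq, Set.mem_union]; omega)
    (by rw [Set.disjoint_left]; intro p; simp only [Set.mem_ofPred_eq]; omega)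
  have heven4 := latticeSum_union h0 h1 h7
    (s := {p | p.1 % 4 = 2 ∧ (p.1 - p.2) % 8 = 4})
    (t := {p | p.1 % 4 = 0 ∧ (p.1 - p.2) % 8 = 4})
    (u := {p | p.1 % 2 = 0 ∧ (p.1 - p.2) % 8 = 4})
    (by ext p; simp only [Set.mem_ofPred_eq, Set.mem_union]; omega)
    (by rw [Set.disjoint_left]; intro p; simp only [Set.mem_ofPred_eq]; omega)
  have hfour0 := latticeSum_union h0 h1 h7
    (s := {p | p.1 % 8 = 4 * 0 ∧ p.2 % 8 = 4 * 0})
    (t := {p | p.1 % 8 = 4 * 1 ∧ p.2 % 8 = 4 * 1})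
    (u := {p | p.1 % 4 = 0 ∧ (p.1 - p.2) % 8 = 0})
    (by ext p; simp only [Set.mem_ofPred_eq, Set.mem_union]; omega)
    (by rw [Set.disjoint_left]; intro p; simp only [Set.mem_ofPred_eq]; omega)
  have hfour4 := latticeSum_union h0 h1 h7
    (s := {p | p.1 % 8 = 4 * 0 ∧ p.2 % 8 = 4 * 1})
    (t := {p | p.1 % 8 = 4 * 1 ∧ p.2 % 8 = 4 * 0})
    (u := {p | p.1 % 4 = 0 ∧ (p.1 - p.2) % 8 = 4})
    (by ext p; simp only [Set.mem_ofPred_eq, Set.mem_union]; omega)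
    (by rw [Set.disjoint_left]; intro p; simp only [Set.mem_ofPred_eq]; omega)
  rw [← ho, ← hP]
  linear_combination 2 * hsplit + 2 * heven0 + 2 * hfour0 + 2 * h00 + 2 * h11 - hodd - hneg -
    2 * hodd' - 2 * hrot - 2 * heven4 - 2 * hneg' - 2 * hfour4 - 2 * h01 - 2 * h10

/-! ### The ratio `φ(-q)/φ(q)`: inversion, Landen, Jacobi -/

/-- `φ(e^{-πt})`. -/
noncomputable def phiExp (t : ℝ) : ℝ := ramanujanPhi (rexp (-π * t))

/-- `φ(-q)/φ(q)` for `q = e^{-πt}`, written through `φ(-q) = 2φ(q⁴) - φ(q)`. -/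
noncomputable def phiRatio (t : ℝ) : ℝ := (2 * phiExp (4 * t) - phiExp t) / phiExp t

theorem exp_neg_pi_mul_lt_one {t : ℝ} (ht : 0 < t) : rexp (-π * t) < 1 := by
  rw [exp_lt_one_iff]
  nlinarith [pi_pos]

theorem ramanujanPhi_exp_pow (t : ℝ) (k : ℕ) :
    ramanujanPhi (rexp (-π * t) ^ k) = phiExp (k * t) := by
  rw [phiExp, ← Real.exp_nat_mul]
  ring_nf

theorem one_le_phiExp {t : ℝ} (ht : 0 < t) : 1 ≤ phiExp t := by
  have h := summable_zpow_sq (exp_pos _) (exp_neg_pi_mul_lt_one ht) one_pos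
  simp only [one_mul] at h
  have := h.le_tsum 0 (fun n _ => (zpow_pos (exp_pos _) _).le)
  rw [phiExp, ramanujanPhi]
  refine le_trans ?_ this
  simp

theorem phiExp_pos {t : ℝ} (ht : 0 < t) : 0 < phiExp t := one_pos.trans_le (one_le_phiExp ht)

theorem oddPhi_exp {t : ℝ} (ht : 0 < t) :
    oddPhi (rexp (-π * t)) = phiExp t - phiExp (4 * t) := by
  have h := ramanujanPhi_eq_add_oddPhi (exp_pos _) (exp_neg_pi_mul_lt_one ht)
  rw [ramanujanPhi_exp_pow] at h
  push_cast at h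
  rw [phiExp, h]
  ring

theorem oddPhi_exp_pow {t : ℝ} (ht : 0 < t) (k : ℕ) (hk : 0 < k) :
    oddPhi (rexp (-π * t) ^ k) = phiExp (k * t) - phiExp (4 * (k * t)) := by
  rw [← oddPhi_exp (by positivity), ← Real.exp_nat_mul]
  ring_nf

theorem oddPhi_pos {q : ℝ} (h0 : 0 < q) (h1 : q < 1) : 0 < oddPhi q := by
  have h := summable_zpow_odd_sq h0 h1 one_pos
  simp only [one_mul] at h
  exact h.tsum_pos (fun n => (zpow_pos h0 _).le) 0 (zpow_pos h0 _)

theorem phiExp_four_mul_lt {t : ℝ} (ht : 0 < t) : phiExp (4 * t) < phiExp t := by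
  have := oddPhi_pos (exp_pos _) (exp_neg_pi_mul_lt_one ht)
  rw [oddPhi_exp ht] at this
  linarith

theorem phiExp_two_mul_sq {t : ℝ} (ht : 0 < t) :
    phiExp (2 * t) ^ 2 = phiExp (4 * t) ^ 2 + (phiExp t - phiExp (4 * t)) ^ 2 := by
  have h := ramanujanPhi_sq_sq (exp_pos _) (exp_neg_pi_mul_lt_one ht)
  rw [ramanujanPhi_exp_pow, ramanujanPhi_exp_pow, oddPhi_exp ht] at h
  exact_mod_cast h

theorem phiExp_inv {t : ℝ} (ht : 0 < t) : phiExp t⁻¹ = √t * phiExp t := by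
  have key : ∀ s : ℝ, phiExp s = ∑' n : ℤ, rexp (-π * s * (n : ℝ) ^ 2) := by
    intro s
    refine tsum_congr fun n => ?_
    rw [← Real.rpow_intCast, ← Real.exp_mul]
    push_cast
    rfl
  have h := Real.tsum_exp_neg_mul_int_sq ht
  rw [← key, ← Real.sqrt_eq_rpow] at h
  rw [h, key]
  have : √t ≠ 0 := (Real.sqrt_pos.2 ht).ne'
  field_simp

/-- Inversion exchanges `θ₄/θ₃` with `θ₂/θ₃`: the numerator on the right is the odd part of `φ` at
`q^{1/4}`. -/
theorem phiRatio_inv {t : ℝ} (ht : 0 < t) :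
    phiRatio t⁻¹ = (phiExp (t / 4) - phiExp t) / phiExp t := by
  have h4 : 4 * t⁻¹ = (t / 4)⁻¹ := by field_simp
  have hs : √(t / 4) = √t / 2 := by
    rw [Real.sqrt_div ht.le, show (4 : ℝ) = 2 ^ 2 by norm_num, Real.sqrt_sq (by norm_num)]
  have : √t ≠ 0 := (Real.sqrt_pos.2 ht).ne'
  have := (phiExp_pos ht).ne'
  rw [phiRatio, h4, phiExp_inv (by positivity), phiExp_inv ht, hs]
  field_simp

theorem phiRatio_lt_one {t : ℝ} (ht : 0 < t) : phiRatio t < 1 := by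
  rw [phiRatio, div_lt_one (phiExp_pos ht)]
  linarith [phiExp_four_mul_lt ht]

/-- The series for `φ(-q)` alternates, so its sign is read off after inversion, where the numerator
is a sum of positive terms. -/
theorem phiRatio_pos {t : ℝ} (ht : 0 < t) : 0 < phiRatio t := by
  have h := phiRatio_inv (inv_pos.2 ht)
  rw [inv_inv] at h
  rw [h]
  have h4 := phiExp_four_mul_lt (t := t⁻¹ / 4) (by positivity)
  rw [mul_div_cancel₀ _ (by norm_num)] at h4
  exact div_pos (by linarith) (phiExp_pos (by positivity))

/-- Landen's transformation. -/
theorem phiRatio_two_mul {t : ℝ} (ht : 0 < t) :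
    phiRatio (2 * t) ^ 2 * (1 + phiRatio t ^ 2) = 2 * phiRatio t := by
  have h1 := phiExp_two_mul_sq ht
  have h2 := phiExp_two_mul_sq (t := 2 * t) (by positivity)
  have p1 := (phiExp_pos ht).ne'
  have p2 := (phiExp_pos (t := 2 * t) (by positivity)).ne'
  rw [← mul_assoc, show (2 : ℝ) * 2 = 4 by norm_num] at h2
  -- This is `φ(-q²)² = φ(q)φ(-q)`; the next identity is `φ(q)² + φ(-q)² = 2φ(q²)²`.
  have h3 : (2 * phiExp (4 * (2 * t)) - phiExp (2 * t)) ^ 2 =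
      phiExp t * (2 * phiExp (4 * t) - phiExp t) := by
    linear_combination (-2) * h2 - h1
  have h4 : phiExp t ^ 2 + (2 * phiExp (4 * t) - phiExp t) ^ 2 = 2 * phiExp (2 * t) ^ 2 := by
    linear_combination -2 * h1
  rw [phiRatio, phiRatio, div_pow, h3]
  have h5 : 1 + ((2 * phiExp (4 * t) - phiExp t) / phiExp t) ^ 2 =
      2 * phiExp (2 * t) ^ 2 / phiExp t ^ 2 := by
    rw [← h4]
    field_simp
  rw [h5]
  field_simp

/-- Jacobi's quartic identity. -/
theorem phiRatio_pow_four_add {t : ℝ} (ht : 0 < t) :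
    phiRatio t ^ 4 + phiRatio t⁻¹ ^ 4 = 1 := by
  have h1 := phiExp_two_mul_sq ht
  have h2 := phiExp_two_mul_sq (t := t / 2) (by positivity)
  have h3 := phiExp_two_mul_sq (t := t / 4) (by positivity)
  rw [show 2 * (t / 2) = t by ring, show 4 * (t / 2) = 2 * t by ring] at h2
  rw [show 2 * (t / 4) = t / 2 by ring, show 4 * (t / 4) = t by ring] at h3
  have p1 := (phiExp_pos ht).ne'
  rw [phiRatio_inv ht, phiRatio]
  set a := phiExp (t / 4)
  set b := phiExp (t / 2)
  set c := phiExp t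
  set d := phiExp (2 * t)
  set e := phiExp (4 * t)
  have e4 : (2 * e - c) ^ 2 = 2 * b * d - b ^ 2 := by linear_combination -2 * h1 - h2
  have e2 : (a - c) ^ 2 = 2 * d * (b - d) := by linear_combination -h3 - h2
  have : (2 * e - c) ^ 4 + (a - c) ^ 4 = c ^ 4 := by
    calc (2 * e - c) ^ 4 + (a - c) ^ 4 = ((2 * e - c) ^ 2) ^ 2 + ((a - c) ^ 2) ^ 2 := by ring
      _ = (d ^ 2 + (b - d) ^ 2) ^ 2 := by rw [e4, e2]; ring
      _ = (c ^ 2) ^ 2 := by rw [h2]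
      _ = c ^ 4 := by ring
  rw [div_pow, div_pow, ← add_div, this, div_self (pow_ne_zero 4 p1)]

/-! ### Modular equations of degrees three and seven -/

/-- The modular equation of degree three. -/
theorem phiRatio_degree_three {t : ℝ} (ht : 0 < t) :
    phiRatio t * phiRatio (3 * t) + phiRatio t⁻¹ * phiRatio (3 * t)⁻¹ = 1 := by
  have h4 : 0 < t / 4 := by positivity
  have h := oddPhi_mul_oddPhi_cube (exp_pos (-π * (t / 4))) (exp_neg_pi_mul_lt_one h4)
  rw [oddPhi_exp h4, ramanujanPhi_exp_pow, ramanujanPhi_exp_pow, oddPhi_exp_pow h4 3 (by norm_num),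
    oddPhi_exp_pow h4 12 (by norm_num), oddPhi_exp_pow h4 4 (by norm_num)] at h
  push_cast at h
  rw [show 3 * (t / 4) = 3 * t / 4 by ring, show 4 * (3 * t / 4) = 3 * t by ring,
    show 16 * (t / 4) = 4 * t by ring, show 12 * (t / 4) = 3 * t by ring,
    show 4 * (t / 4) = t by ring, show 48 * (t / 4) = 4 * (3 * t) by ring] at h
  have p1 := (phiExp_pos ht).ne'
  have p3 := (phiExp_pos (t := 3 * t) (by positivity)).ne'
  rw [phiRatio_inv ht, phiRatio_inv (by positivity), phiRatio, phiRatio]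
  generalize phiExp (3 * t) = Q at *
  generalize phiExp (4 * (3 * t)) = Q' at *
  generalize phiExp (3 * t / 4) = Q'' at *
  field_simp
  linear_combination h

/-- The modular equation of degree seven. -/
theorem phiRatio_degree_seven {t : ℝ} (ht : 0 < t) :
    √(phiRatio t * phiRatio (7 * t)) + √(phiRatio t⁻¹ * phiRatio (7 * t)⁻¹) = 1 := by
  -- These are `θ₂(q^{1/2})² = 2θ₂(q)θ₃(q)` and `θ₄(q²)² = θ₃(q)θ₄(q)`, with the signs that let the
  -- square roots be taken.
  have key : ∀ s : ℝ, 0 < s → 0 < phiExp (s / 8) - phiExp (s / 2) ∧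
      0 < phiExp (8 * s) - (phiExp (2 * s) - phiExp (8 * s)) ∧
      (phiExp (s / 8) - phiExp (s / 2)) ^ 2 = 2 * phiRatio s⁻¹ * phiExp s ^ 2 ∧
      (phiExp (8 * s) - (phiExp (2 * s) - phiExp (8 * s))) ^ 2 = phiRatio s * phiExp s ^ 2 := by
    intro s hs
    have p1 := (phiExp_pos hs).ne'
    have h8 := phiExp_four_mul_lt (t := s / 8) (by positivity)
    rw [show 4 * (s / 8) = s / 2 by ring] at h8
    have hp := phiRatio_pos (t := 2 * s) (by positivity)
    rw [phiRatio, div_pos_iff_of_pos_right (phiExp_pos (by positivity)),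
      show 4 * (2 * s) = 8 * s by ring] at hp
    have l1 := phiExp_two_mul_sq (t := s / 8) (by positivity)
    have l2 := phiExp_two_mul_sq (t := s / 4) (by positivity)
    have l3 := phiExp_two_mul_sq hs
    have l4 := phiExp_two_mul_sq (t := 2 * s) (by positivity)
    rw [show 2 * (s / 8) = s / 4 by ring, show 4 * (s / 8) = s / 2 by ring] at l1
    rw [show 2 * (s / 4) = s / 2 by ring, show 4 * (s / 4) = s by ring] at l2
    rw [show 2 * (2 * s) = 4 * s by ring, show 4 * (2 * s) = 8 * s by ring] at l4
    refine ⟨by linarith, by linarith, ?_, ?_⟩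
    · rw [phiRatio_inv hs]
      field_simp
      linear_combination -l1 - l2
    · rw [phiRatio]
      generalize phiExp (2 * s) = Q at *
      generalize phiExp (4 * s) = Q' at *
      generalize phiExp (8 * s) = Q'' at *
      field_simp
      linear_combination -2 * l4 - l3
  have h8 : 0 < t / 8 := by positivity
  have h := ramanujanPhi_mul_ramanujanPhi_seven (exp_pos (-π * (t / 8)))
    (exp_neg_pi_mul_lt_one h8)
  rw [oddPhi_exp h8, ramanujanPhi_exp_pow, ramanujanPhi_exp_pow, ramanujanPhi_exp_pow,
    ramanujanPhi_exp_pow, oddPhi_exp_pow h8 7 (by norm_num), oddPhi_exp_pow h8 16 (by norm_num),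
    oddPhi_exp_pow h8 112 (by norm_num)] at h
  push_cast at h
  rw [show 8 * (t / 8) = t by ring, show 56 * (t / 8) = 7 * t by ring,
    show 4 * (t / 8) = t / 2 by ring, show 4 * (7 * (t / 8)) = 7 * t / 2 by ring,
    show 7 * (t / 8) = 7 * t / 8 by ring, show 64 * (t / 8) = 8 * t by ring,
    show 4 * (16 * (t / 8)) = 8 * t by ring, show 16 * (t / 8) = 2 * t by ring,
    show 448 * (t / 8) = 8 * (7 * t) by ring, show 4 * (112 * (t / 8)) = 8 * (7 * t) by ring,
    show 112 * (t / 8) = 2 * (7 * t) by ring] at h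
  obtain ⟨a1, b1, a2, b2⟩ := key t ht
  obtain ⟨c1, d1, c2, d2⟩ := key (7 * t) (by positivity)
  have p1 := phiExp_pos ht
  have p7 := phiExp_pos (t := 7 * t) (by positivity)
  set A := phiExp (t / 8) - phiExp (t / 2)
  set B := phiExp (8 * t) - (phiExp (2 * t) - phiExp (8 * t))
  set C := phiExp (7 * t / 8) - phiExp (7 * t / 2)
  set D := phiExp (8 * (7 * t)) - (phiExp (2 * (7 * t)) - phiExp (8 * (7 * t)))
  set P := phiExp t
  set Q := phiExp (7 * t)
  have e1 : phiRatio t * phiRatio (7 * t) = (B * D / (P * Q)) ^ 2 := by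
    rw [div_pow, mul_pow, b2, d2]
    field_simp
  have e2 : phiRatio t⁻¹ * phiRatio (7 * t)⁻¹ = (A * C / (2 * (P * Q))) ^ 2 := by
    rw [div_pow, mul_pow A, a2, c2]
    field_simp
  rw [e1, e2, Real.sqrt_sq (by positivity), Real.sqrt_sq (by positivity)]
  field_simp
  linear_combination -h

/-! ### Bounds, reduction of `A'_{4,n}`, and root selection -/

theorem three_quarters_lt_phiRatio {t : ℝ} (ht : 1 ≤ t) : 3 / 4 < phiRatio t := by
  have h0 : 0 < t := by linarith
  have hq : rexp (-π * t) < 1 / 16 := by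
    have h3 : rexp (-π * t) ≤ rexp (-3) := exp_le_exp.2 (by nlinarith [pi_gt_three])
    have h4 : (16 : ℝ) < rexp 3 := by
      have := exp_one_gt_d9
      calc (16 : ℝ) < 2.7 ^ 3 := by norm_num
        _ < rexp 1 ^ 3 := by gcongr; linarith
        _ = rexp 3 := by rw [← Real.exp_nat_mul]; norm_num
    rw [Real.exp_neg] at h3
    refine h3.trans_lt ?_
    rw [one_div]
    exact inv_strictAnti₀ (by norm_num) h4
  -- Comparison with a geometric series of ratio below `1/16`. With `φ(e^{-4πt}) ≥ 1` this gives a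
  -- ratio of at least `2 · 15/17 - 1 = 13/17`.
  have hle : phiExp t ≤ 1 + 2 * (1 / 15) := by
    generalize hqd : rexp (-π * t) = q at *
    have hq0 : 0 < q := hqd ▸ exp_pos _
    have hq1 : q < 1 := by linarith
    have hN : Summable fun n : ℕ => q ^ ((n : ℤ) ^ 2) := by
      have h := (summable_zpow_sq hq0 hq1 one_pos).comp_injective Nat.cast_injective
      simpa only [one_mul, Function.comp_def] using h
    have hb : ∑' n : ℕ, q ^ ((n : ℤ) ^ 2) ≤ 16 / 15 := by
      refine (hN.tsum_le_tsum (fun n => ?_) (summable_geometric_of_lt_one hq0.le hq1)).trans ?_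
      · rw [← zpow_natCast q n]
        exact zpow_le_zpow_right_of_le_one₀ hq0 hq1.le (Int.le_self_sq _)
      · rw [tsum_geometric_of_lt_one hq0.le hq1, inv_le_comm₀ (by linarith) (by norm_num)]
        linarith
    have hs := (hN.hasSum.of_nat_of_neg (f := fun n : ℤ => q ^ (n ^ 2))
      (by simpa only [neg_sq] using hN.hasSum)).tsum_eq
    rw [phiExp, hqd, ramanujanPhi, hs]
    norm_num
    linarith
  have h4 := one_le_phiExp (t := 4 * t) (by positivity)
  rw [phiRatio, lt_div_iff₀ (phiExp_pos h0)]
  linarith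

theorem thetaParamA'_four {n : ℝ} (hn : 0 < n) :
    thetaParamA' 4 n = √2 / (1 - phiRatio (√n / 2)) := by
  have ht : 0 < √n / 2 := by positivity
  have hnome : thetaNome 4 n = rexp (-π * (√n / 2)) := by
    rw [thetaNome, Real.sqrt_div hn.le, show (4 : ℝ) = 2 ^ 2 by norm_num,
      Real.sqrt_sq (by norm_num)]
  have h4 : (4 : ℝ) ^ (1 / 4 : ℝ) = √2 := by
    rw [show (4 : ℝ) = 2 ^ (2 : ℝ) by norm_num, ← Real.rpow_mul (by norm_num), Real.sqrt_eq_rpow]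
    norm_num
  have h0 := exp_pos (-π * (√n / 2))
  have h1 := exp_neg_pi_mul_lt_one ht
  have hodd := oddPhi_exp ht
  rw [thetaParamA', hnome, h4]
  -- The indices `2n + 1` and `-(2n + 1)` pair up, and `(2n + 1)² = 8 · n(n + 1)/2 + 1`.
  have hpsi : ∀ q : ℝ, 0 < q → q < 1 → oddPhi q = 2 * (q * ramanujanPsi (q ^ (2 * 4 : ℝ))) := by
    intro q h0 h1
    have hN : Summable fun n : ℕ => q ^ ((2 * (n : ℤ) + 1) ^ 2) := by
      have h := (summable_zpow_odd_sq h0 h1 one_pos).comp_injective Nat.cast_injective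
      simpa only [one_mul, Function.comp_def] using h
    have hneg : ∀ n : ℤ, (2 * -(n + 1) + 1) ^ 2 = (2 * n + 1) ^ 2 := fun n => by ring
    have hs := tsum_of_nat_of_neg_add_one (f := fun n : ℤ => q ^ ((2 * n + 1) ^ 2))
      hN (by simpa only [hneg] using hN)
    simp only [hneg] at hs
    rw [oddPhi, hs, ← two_mul]
    congr 1
    rw [ramanujanPsi, ← tsum_mul_left]
    refine tsum_congr fun n => ?_
    rw [show (2 * 4 : ℝ) = (8 : ℕ) by norm_num, Real.rpow_natCast, ← pow_mul, ← pow_succ',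
      ← zpow_natCast]
    congr 1
    have : 2 ∣ n * (n + 1) := (Nat.even_mul_succ_self n).two_dvd
    obtain ⟨k, hk⟩ := this
    rw [hk, Nat.mul_div_cancel_left _ (by norm_num)]
    have hk' : (n : ℤ) * (n + 1) = 2 * k := by exact_mod_cast hk
    push_cast
    linear_combination 4 * hk'
  have hp := oddPhi_pos h0 h1
  have hpsi := hpsi _ h0 h1
  have p := phiExp_pos ht
  rw [div_self (by norm_num), Real.rpow_one, phiRatio]
  have : 1 - (2 * phiExp (4 * (√n / 2)) - phiExp (√n / 2)) / phiExp (√n / 2) =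
      2 * oddPhi (rexp (-π * (√n / 2))) / phiExp (√n / 2) := by
    rw [hodd]
    field_simp
    ring
  rw [this, show 2 * √2 * rexp (-π * (√n / 2)) * ramanujanPsi (rexp (-π * (√n / 2)) ^ (2 * 4 : ℝ))
    = √2 * oddPhi (rexp (-π * (√n / 2))) by rw [hpsi]; ring, ← phiExp]
  have h2 : √2 ≠ 0 := by positivity
  field_simp
  norm_num

/-- Rationalizing gives `√2(1 + x)/(1 - x²)`, whose two terms are the roots of `M₁` and `M₂`; only
`x²` need be known. -/
theorem sqrt_two_div_one_sub_eq_add {x w M₁ M₂ : ℝ} (hx0 : 0 < x) (hx1 : x < 1)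
    (hw : x ^ 2 = w) (h₁ : M₁ * (1 - w) ^ 2 = 2) (h₂ : M₂ * (1 - w) ^ 2 = 2 * w) :
    √2 / (1 - x) = √M₁ + √M₂ := by
  have h1w : 0 < 1 - w := by nlinarith
  have h1x : 1 - x ≠ 0 := by linarith
  have hs : √2 ^ 2 = 2 := Real.sq_sqrt (by norm_num)
  have e₁ : M₁ = (√2 / (1 - w)) ^ 2 := by
    rw [div_pow, hs, eq_div_iff (by positivity), h₁]
  have e₂ : M₂ = (√2 * x / (1 - w)) ^ 2 := by
    rw [div_pow, mul_pow, hs, eq_div_iff (by positivity), h₂, hw]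
  rw [e₁, e₂, Real.sqrt_sq (by positivity), Real.sqrt_sq (by positivity)]
  rw [← add_div, div_eq_div_iff h1x h1w.ne', ← hw]
  ring

/-- The same rationalization after splitting off `√2`: the remainder is `√2(x² + x)/(1 - x²)`. -/
theorem sqrt_two_div_one_sub_eq_add_add {x w M₁ M₂ : ℝ} (hx0 : 0 < x) (hx1 : x < 1)
    (hw : x ^ 2 = w) (h₁ : M₁ * (1 - w) ^ 2 = 2 * w ^ 2) (h₂ : M₂ * (1 - w) ^ 2 = 2 * w) :
    √2 / (1 - x) = √2 + √M₁ + √M₂ := by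
  have h1w : 0 < 1 - w := by nlinarith
  have hw0 : 0 < w := hw ▸ pow_pos hx0 2
  have h1x : 1 - x ≠ 0 := by linarith
  have hs : √2 ^ 2 = 2 := Real.sq_sqrt (by norm_num)
  have e₁ : M₁ = (√2 * w / (1 - w)) ^ 2 := by
    rw [div_pow, mul_pow, hs, eq_div_iff (by positivity), h₁]
  have e₂ : M₂ = (√2 * x / (1 - w)) ^ 2 := by
    rw [div_pow, mul_pow, hs, eq_div_iff (by positivity), h₂, hw]
  rw [e₁, e₂, Real.sqrt_sq (by positivity), Real.sqrt_sq (by positivity)]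
  field_simp
  rw [← hw]
  ring

/-- `y ↦ 2y / (1 + y²)` is injective on the unit interval. -/
theorem eq_of_landen_eq {w y z : ℝ} (hy0 : 0 < y) (hy1 : y < 1) (hz1 : z < 1)
    (hy : w * (1 + y ^ 2) = 2 * y) (hz : w * (1 + z ^ 2) = 2 * z) : y = z := by
  have h : (y - z) * (1 - y * z) = 0 := by
    linear_combination (1 + y ^ 2) / 2 * hz - (1 + z ^ 2) / 2 * hy
  rcases mul_eq_zero.1 h with h | h
  · linarith
  · nlinarith

/-! ### Special values of the ratio -/

theorem phiRatio_one_pow_four : phiRatio 1 ^ 4 = 1 / 2 := by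
  have h := phiRatio_pow_four_add one_pos
  rw [inv_one] at h
  linarith

theorem phiRatio_one_sq : phiRatio 1 ^ 2 = √2 / 2 := by
  have h2 : √2 ^ 2 = 2 := Real.sq_sqrt (by norm_num)
  have h := phiRatio_one_pow_four
  refine (sq_eq_sq₀ (by positivity) (by positivity)).1 ?_
  rw [div_pow, h2, ← pow_mul]
  norm_num
  linarith

theorem phiRatio_half : phiRatio (1 / 2) = √2 - 1 := by
  have h2 : √2 ^ 2 = 2 := Real.sq_sqrt (by norm_num)
  have h := phiRatio_two_mul (t := 1 / 2) (by norm_num)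
  rw [show (2 : ℝ) * (1 / 2) = 1 by norm_num, phiRatio_one_sq] at h
  refine eq_of_landen_eq (phiRatio_pos (by norm_num)) (phiRatio_lt_one (by norm_num)) ?_ h ?_
  · nlinarith [Real.sqrt_nonneg 2]
  · linear_combination (√2 / 2 - 1) * h2

/-- Doubling `√2/2` also inverts it, so Landen and Jacobi close up into a quartic for `s = x²`. -/
theorem phiRatio_sqrt_two_div_two_sq : phiRatio (√2 / 2) ^ 2 = √2 - 1 := by
  have h2 : √2 ^ 2 = 2 := Real.sq_sqrt (by norm_num)
  have hp : 0 < √2 / 2 := by positivity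
  have hinv : (√2 / 2)⁻¹ = √2 := by
    field_simp
    linarith
  have h := phiRatio_two_mul hp
  have hj := phiRatio_pow_four_add hp
  rw [hinv] at hj
  rw [show 2 * (√2 / 2) = √2 by ring] at h
  have hx := phiRatio_pos hp
  set x := phiRatio (√2 / 2)
  set X := phiRatio √2
  have h4 : X ^ 4 * (1 + x ^ 2) ^ 2 = 4 * x ^ 2 := by
    calc X ^ 4 * (1 + x ^ 2) ^ 2 = (X ^ 2 * (1 + x ^ 2)) ^ 2 := by ring
      _ = 4 * x ^ 2 := by rw [h]; ring
  have hX : X ^ 4 = 1 - x ^ 4 := by linarith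
  rw [hX] at h4
  have hr : 0 < √2 - 1 := by nlinarith [Real.sqrt_nonneg 2]
  have hs : 0 < x ^ 2 := by positivity
  have hsx : x ^ 4 = (x ^ 2) ^ 2 := by ring
  rw [hsx] at h4
  generalize x ^ 2 = s at *
  obtain ⟨r, hrd⟩ : ∃ r, r = √2 - 1 := ⟨_, rfl⟩
  rw [← hrd] at hr ⊢
  have hr2 : r ^ 2 = 1 - 2 * r := by rw [hrd]; linear_combination h2
  -- The quartic is `s⁴ + 2s³ + 2s = 1`, also satisfied by `r`; the left side is increasing for
  -- positive arguments, hence the positive cofactor.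
  have h0 : (s - r) * (2 + 2 * (s ^ 2 + s * r + r ^ 2) + (s + r) * (s ^ 2 + r ^ 2)) = 0 := by
    linear_combination -h4 - (r ^ 2 + 1) * hr2
  have : 0 < 2 + 2 * (s ^ 2 + s * r + r ^ 2) + (s + r) * (s ^ 2 + r ^ 2) := by positivity
  rcases mul_eq_zero.1 h0 with h | h
  · linarith
  · linarith

theorem phiRatio_sqrt_two_sq : phiRatio √2 ^ 2 = (2 - √2) * √(1 + √2) := by
  have h2 : √2 ^ 2 = 2 := Real.sq_sqrt (by norm_num)
  have ha : √(1 + √2) ^ 2 = 1 + √2 := Real.sq_sqrt (by positivity)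
  have hp : 0 < √2 / 2 := by positivity
  have hinv : (√2 / 2)⁻¹ = √2 := by
    field_simp
    linarith
  have hj := phiRatio_pow_four_add hp
  rw [hinv] at hj
  have h := phiRatio_sqrt_two_div_two_sq
  have hlt : √2 ≤ 2 := by nlinarith [Real.sqrt_nonneg 2]
  refine (sq_eq_sq₀ (by positivity) (mul_nonneg (by linarith) (by positivity))).1 ?_
  rw [mul_pow, ha]
  linear_combination hj - (phiRatio (√2 / 2) ^ 2 + √2 - 1) * h - (√2 - 2) * h2

/-- Two values in the unit interval whose fourth powers sum to `1`, the first one being larger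
than `3/4`, are determined by their product. -/
theorem sq_eq_of_pow_four_add {x y w c : ℝ} (hx : 3 / 4 < x)
    (hj : x ^ 4 + y ^ 4 = 1) (hxy : x * y = c) (hw0 : 0 < w) (hw : w ^ 2 * (1 - w ^ 2) = c ^ 4)
    (hw1 : 3 / 4 < w ^ 2) : x ^ 2 = w := by
  have h : (x ^ 4 - w ^ 2) * (x ^ 4 + w ^ 2 - 1) = 0 := by
    rw [← hxy] at hw
    linear_combination x ^ 4 * hj + hw
  have h4 : (1 / 4 : ℝ) < x ^ 4 := by
    calc (1 / 4 : ℝ) < (3 / 4) ^ 4 := by norm_num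
      _ < x ^ 4 := by gcongr
  rcases mul_eq_zero.1 h with h | h
  · refine (sq_eq_sq₀ (by positivity) hw0.le).1 ?_
    linarith
  · linarith

/-- At `t = 1/√3`, tripling is inversion, so the degree three equation reads `2 x(√3) x(1/√3) = 1`.
-/
theorem phiRatio_sqrt_three_sq : phiRatio √3 ^ 2 = (√2 * √3 + √2) / 4 := by
  have h2 : √2 ^ 2 = 2 := Real.sq_sqrt (by norm_num)
  have h3 : √3 ^ 2 = 3 := Real.sq_sqrt (by norm_num)
  have hp : 0 < √3 / 3 := by positivity
  have hinv : (√3 / 3)⁻¹ = √3 := by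
    field_simp
    linarith
  have h := phiRatio_degree_three hp
  have hj := phiRatio_pow_four_add hp
  rw [show 3 * (√3 / 3) = √3 by ring, show (√3)⁻¹ = √3 / 3 by rw [inv_eq_iff_eq_inv, hinv], hinv] at h
  rw [hinv] at hj
  have h1 : 3 / 2 < √3 := by rw [Real.lt_sqrt] <;> norm_num
  have hw : ((√2 * √3 + √2) / 4) ^ 2 = (2 + √3) / 4 := by
    linear_combination (√3 + 1) ^ 2 / 16 * h2 + h3 / 8
  refine sq_eq_of_pow_four_add (c := 1 / 2) (three_quarters_lt_phiRatio (by linarith))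
    (by rw [add_comm]; exact hj) (by linarith) (by positivity) ?_ ?_
  · rw [hw]
    linear_combination -h3 / 16
  · rw [hw]
    linarith

/-- At `t = 1/√7`, multiplication by 7 is inversion, so the two square roots in the degree seven
equation coincide and each is `1/2`. -/
theorem phiRatio_sqrt_seven_sq : phiRatio √7 ^ 2 = (3 + √7) * √2 / 8 := by
  have h2 : √2 ^ 2 = 2 := Real.sq_sqrt (by norm_num)
  have h7 : √7 ^ 2 = 7 := Real.sq_sqrt (by norm_num)
  have hp : 0 < √7 / 7 := by positivity
  have hinv : (√7 / 7)⁻¹ = √7 := by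
    field_simp
    linarith
  have h := phiRatio_degree_seven hp
  have hj := phiRatio_pow_four_add hp
  rw [show 7 * (√7 / 7) = √7 by ring, show (√7)⁻¹ = √7 / 7 by rw [inv_eq_iff_eq_inv, hinv], hinv,
    mul_comm (phiRatio (√7 / 7)), ← two_mul] at h
  rw [hinv] at hj
  have h1 : 1 ≤ √7 := by rw [Real.one_le_sqrt]; norm_num
  have hc : phiRatio √7 * phiRatio (√7 / 7) = 1 / 4 := by
    have hs := Real.sq_sqrt
      (mul_pos (phiRatio_pos (t := √7) (by positivity)) (phiRatio_pos hp)).le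
    rw [← hs, show √(phiRatio √7 * phiRatio (√7 / 7)) = 1 / 2 by linarith]
    norm_num
  have hw : ((3 + √7) * √2 / 8) ^ 2 = (8 + 3 * √7) / 16 := by
    linear_combination (3 + √7) ^ 2 / 64 * h2 + h7 / 32
  refine sq_eq_of_pow_four_add (three_quarters_lt_phiRatio h1)
    (by rw [add_comm]; exact hj) hc (by positivity) ?_ ?_
  · rw [hw]
    linear_combination -9 * h7 / 256
  · rw [hw]
    have : 2 ≤ √7 := Real.le_sqrt_of_sq_le (by norm_num)
    linarith

theorem phiRatio_sqrt_three_div_two : phiRatio (√3 / 2) = 1 - (√3 - √2) * (√3 - 1) := by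
  have h2 : √2 ^ 2 = 2 := Real.sq_sqrt (by norm_num)
  have h3 : √3 ^ 2 = 3 := Real.sq_sqrt (by norm_num)
  have hp : 0 < √3 / 2 := by positivity
  have h := phiRatio_two_mul hp
  rw [show 2 * (√3 / 2) = √3 by ring, phiRatio_sqrt_three_sq] at h
  refine eq_of_landen_eq (phiRatio_pos hp) (phiRatio_lt_one hp) ?_ h ?_
  · have : √2 < √3 := Real.sqrt_lt_sqrt (by norm_num) (by norm_num)
    have h1 : 1 < √3 := by rw [Real.lt_sqrt] <;> norm_num
    nlinarith
  · generalize √2 = a at *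
    generalize √3 = b at *
    grind

theorem phiRatio_sqrt_seven_div_two :
    phiRatio (√7 / 2) = 1 - (3 - √7) * (3 - 2 * √2) := by
  have h2 : √2 ^ 2 = 2 := Real.sq_sqrt (by norm_num)
  have h7 : √7 ^ 2 = 7 := Real.sq_sqrt (by norm_num)
  have hp : 0 < √7 / 2 := by positivity
  have h := phiRatio_two_mul hp
  rw [show 2 * (√7 / 2) = √7 by ring, phiRatio_sqrt_seven_sq] at h
  refine eq_of_landen_eq (phiRatio_pos hp) (phiRatio_lt_one hp) ?_ h ?_
  · have h3 : √7 < 3 := by rw [Real.sqrt_lt'] <;> norm_num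
    have h1 : √2 < 3 / 2 := by rw [Real.sqrt_lt'] <;> norm_num
    nlinarith
  · generalize √2 = a at *
    generalize √7 = b at *
    grind

/-- Degree three at `t = 1/2`, with Jacobi eliminating both inverted values, gives a monic quartic
in `x(3/2)` that splits into two quadratics over `ℚ(√2, √3)`. -/
theorem phiRatio_three_halves_quadratic :
    (15 + 10 * √2 + 8 * √3 + 6 * (√2 * √3)) * phiRatio (3 / 2) ^ 2 -
      (14 + 10 * √2 + 8 * √3 + 6 * (√2 * √3)) * phiRatio (3 / 2) + 1 = 0 := by
  have h2 : √2 ^ 2 = 2 := Real.sq_sqrt (by norm_num)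
  have h3 : √3 ^ 2 = 3 := Real.sq_sqrt (by norm_num)
  have h := phiRatio_degree_three (t := 1 / 2) (by norm_num)
  have hj := phiRatio_pow_four_add (t := 1 / 2) (by norm_num)
  have hj3 := phiRatio_pow_four_add (t := 3 / 2) (by norm_num)
  rw [show (3 : ℝ) * (1 / 2) = 3 / 2 by norm_num, phiRatio_half] at h
  rw [phiRatio_half] at hj
  have hx := three_quarters_lt_phiRatio (t := 3 / 2) (by norm_num)
  generalize phiRatio (3 / 2) = x at h hj3 hx ⊢
  generalize phiRatio (1 / 2)⁻¹ = X at h hj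
  generalize phiRatio (3 / 2)⁻¹ = Y at h hj3
  have hq : (1 - (√2 - 1) * x) ^ 4 = (1 - (√2 - 1) ^ 4) * (1 - x ^ 4) := by
    rw [show 1 - (√2 - 1) * x = X * Y by linarith,
      show 1 - (√2 - 1) ^ 4 = X ^ 4 by linarith, show 1 - x ^ 4 = Y ^ 4 by linarith, mul_pow]
  have hb2 : √2 < 1.415 := by rw [Real.sqrt_lt'] <;> norm_num
  have ha2 : 1.414 < √2 := by rw [Real.lt_sqrt] <;> norm_num
  have hb3 : √3 < 1.7321 := by rw [Real.sqrt_lt'] <;> norm_num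
  have ha3 : 1.732 < √3 := by rw [Real.lt_sqrt] <;> norm_num
  -- The other quadratic factor, found from Vieta's formulas; `15 - 10√2 + 8√3 - 6√6` is the inverse
  -- of the leading coefficient of the first. Its linear term is nonnegative for `x > 0`, so it has
  -- no root there.
  have hpos : 0 < x ^ 2 - (4 * (√2 - 1) ^ 3 - 1 + (15 - 10 * √2 + 8 * √3 - 6 * (√2 * √3))) * x +
      (√2 - 1) ^ 4 * (15 + 10 * √2 + 8 * √3 + 6 * (√2 * √3)) := by
    have hc : (√2 - 1) ^ 3 = 5 * √2 - 7 := by linear_combination (√2 - 3) * h2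
    have : 4 * (√2 - 1) ^ 3 - 1 + (15 - 10 * √2 + 8 * √3 - 6 * (√2 * √3)) ≤ 0 := by
      rw [hc]
      nlinarith
    have : 0 < (√2 - 1) ^ 4 * (15 + 10 * √2 + 8 * √3 + 6 * (√2 * √3)) :=
      mul_pos (pow_pos (by linarith) 4) (by positivity)
    nlinarith
  refine (mul_eq_zero.1 ?_).resolve_right hpos.ne'
  clear hpos
  generalize √2 = a at *
  generalize √3 = b at *
  grind

/-! ### The nine evaluations -/

theorem mainTheorem3 :
    thetaParamA' 4 1 = 1 + √2 ∧
    thetaParamA' 4 2 = 1 + √2 + √(1 + √2) ∧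
    thetaParamA' 4 3 = (√2 + √3) * (1 + √3) / √2 ∧
    thetaParamA' 4 4 = √(12 + 8 * √2) + √(8 + 6 * √2) ∧
    thetaParamA' 4 7 = (3 + √7) * (3 + 2 * √2) / √2 ∧
    thetaParamA' 4 8 =
      √(62 + 44 * √2 + (28 * √2 + 40) * √(1 + √2)) +
        √(56 + 40 * √2 + (36 + 26 * √2) * √(1 + √2)) ∧
    thetaParamA' 4 9 =
      √(108 + 62 * √3 + 44 * √6 + 76 * √2) + √(93 + 66 * √2 + 38 * √6 + 54 * √3) ∧
    thetaParamA' 4 12 =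
      √2 + √(402 + 232 * √3 + 284 * √2 + 164 * √6) +
        √(416 + 240 * √3 + 294 * √2 + 170 * √6) ∧
    thetaParamA' 4 28 =
      √2 + √2 * √(64641 + 17276 * √14 + 24432 * √7 + 45708 * √2) +
        2 * √(32384 + 22899 * √2 + 12240 * √7 + 8655 * √14) := by
  have h2 : √2 ^ 2 = 2 := Real.sq_sqrt (by norm_num)
  have h3 : √3 ^ 2 = 3 := Real.sq_sqrt (by norm_num)
  have h7 : √7 ^ 2 = 7 := Real.sq_sqrt (by norm_num)
  have h6 : √6 = √2 * √3 := by rw [← Real.sqrt_mul (by norm_num)]; norm_num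
  have h14 : √14 = √2 * √7 := by rw [← Real.sqrt_mul (by norm_num)]; norm_num
  have r4 : √4 = 2 := by rw [show (4 : ℝ) = 2 ^ 2 by norm_num, Real.sqrt_sq (by norm_num)]
  have r9 : √9 = 3 := by rw [show (9 : ℝ) = 3 ^ 2 by norm_num, Real.sqrt_sq (by norm_num)]
  have r8 : √8 = 2 * √2 := by
    rw [show (8 : ℝ) = 4 * 2 by norm_num, Real.sqrt_mul (by norm_num), r4]
  have r12 : √12 = 2 * √3 := by
    rw [show (12 : ℝ) = 4 * 3 by norm_num, Real.sqrt_mul (by norm_num), r4]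
  have r28 : √28 = 2 * √7 := by
    rw [show (28 : ℝ) = 4 * 7 by norm_num, Real.sqrt_mul (by norm_num), r4]
  have p2 : 0 < √2 := by positivity
  have p3 : 0 < √3 := by positivity
  have lt2 : √2 < 3 / 2 := by rw [Real.sqrt_lt'] <;> norm_num
  have lt7 : √7 < 3 := by rw [Real.sqrt_lt'] <;> norm_num
  have lt3 : 3 / 2 < √3 := by rw [Real.lt_sqrt] <;> norm_num
  refine ⟨?_, ?_, ?_, ?_, ?_, ?_, ?_, ?_, ?_⟩
  · rw [thetaParamA'_four (by norm_num), Real.sqrt_one, phiRatio_half,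
      div_eq_iff (by linarith)]
    linear_combination h2
  · rw [thetaParamA'_four (by norm_num)]
    have hx0 := phiRatio_pos (t := √2 / 2) (by positivity)
    have hx1 := phiRatio_lt_one (t := √2 / 2) (by positivity)
    have hx := phiRatio_sqrt_two_div_two_sq
    -- Here `x = 1/√(1 + √2)`, because `(√2 - 1)(√2 + 1) = 1`.
    generalize phiRatio (√2 / 2) = x at *
    have hb : √(1 + √2) ^ 2 = 1 + √2 := Real.sq_sqrt (by positivity)
    have hxb : x * √(1 + √2) = 1 := by
      refine (sq_eq_sq₀ (by positivity) zero_le_one).1 ?_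
      rw [mul_pow, hb, hx]
      linear_combination h2
    rw [div_eq_iff (by linarith)]
    linear_combination (√(1 + √2) + 1) * hxb - x * hb
  · rw [thetaParamA'_four (by norm_num), phiRatio_sqrt_three_div_two, sub_sub_cancel]
    have h : (√2 + √3) * (1 + √3) * ((√3 - √2) * (√3 - 1)) = 2 := by
      grind
    rw [div_eq_div_iff (mul_pos (by linarith) (by linarith)).ne' p2.ne', h]
    linarith
  · rw [thetaParamA'_four (by norm_num), r4, div_self (by norm_num)]
    refine sqrt_two_div_one_sub_eq_add (phiRatio_pos one_pos) (phiRatio_lt_one one_pos)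
      phiRatio_one_sq ?_ ?_
    · grind
    · grind
  · rw [thetaParamA'_four (by norm_num), phiRatio_sqrt_seven_div_two, sub_sub_cancel]
    have h : (3 + √7) * (3 + 2 * √2) * ((3 - √7) * (3 - 2 * √2)) = 2 := by
      linear_combination (4 * √7 ^ 2 - 36) * h2 - h7
    rw [div_eq_div_iff (mul_pos (by linarith) (by linarith)).ne' p2.ne', h]
    linarith
  · rw [thetaParamA'_four (by norm_num), r8, mul_div_cancel_left₀ _ (by norm_num)]
    have hb : √(1 + √2) ^ 2 = 1 + √2 := Real.sq_sqrt (by positivity)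
    refine sqrt_two_div_one_sub_eq_add (phiRatio_pos p2) (phiRatio_lt_one p2)
      phiRatio_sqrt_two_sq ?_ ?_
    · grind
    · grind
  · rw [thetaParamA'_four (by norm_num), r9, h6]
    have hx1 := phiRatio_lt_one (t := 3 / 2) (by norm_num)
    have hx := three_quarters_lt_phiRatio (t := 3 / 2) (by norm_num)
    have hq := phiRatio_three_halves_quadratic
    generalize phiRatio (3 / 2) = x at *
    have hC : √(108 + 62 * √3 + 44 * (√2 * √3) + 76 * √2) =
        5 + 4 * √2 + 3 * √3 + 2 * (√2 * √3) := by
      rw [Real.sqrt_eq_iff_eq_sq (by positivity) (by positivity)]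
      grind
    have hC2 : 93 + 66 * √2 + 38 * (√2 * √3) + 54 * √3 =
        (5 + 4 * √2 + 3 * √3 + 2 * (√2 * √3)) ^ 2 -
          (15 + 10 * √2 + 8 * √3 + 6 * (√2 * √3)) := by
      grind
    rw [hC]
    have hB : 2 * √2 < √2 / (1 - x) := by
      rw [lt_div_iff₀ (by linarith)]
      nlinarith
    have hBx : √2 / (1 - x) * (1 - x) = √2 := div_mul_cancel₀ _ (by linarith)
    generalize √2 / (1 - x) = B at *
    -- The quadratic for `x` rewritten for `B = √2/(1 - x)`: writing it as `B² - 2CB + N = 0`, the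
    -- roots are `C ± √(C² - N)`, and `C² - N` is the second radicand.
    have hB2 : B ^ 2 - 2 * (5 + 4 * √2 + 3 * √3 + 2 * (√2 * √3)) * B +
        (15 + 10 * √2 + 8 * √3 + 6 * (√2 * √3)) = 0 := by
      generalize hN : 15 + 10 * √2 + 8 * √3 + 6 * (√2 * √3) = N at *
      have hq' : N * (1 - x) ^ 2 - (N + 1) * (1 - x) + 2 = 0 := by
        rw [← hN] at hq ⊢
        linear_combination hq
      have hCN : 4 * (5 + 4 * √2 + 3 * √3 + 2 * (√2 * √3)) = √2 * (N + 1) := by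
        rw [← hN]
        linear_combination (-10 - 6 * √3) * h2
      linear_combination B ^ 2 / 2 * hq' - N / 2 * (B * (1 - x) + √2) * hBx +
        (N + 1) / 2 * B * hBx - N / 2 * h2 - B / 2 * hCN
    rw [← sub_eq_iff_eq_add', eq_comm,
      Real.sqrt_eq_iff_eq_sq (by positivity) ?_]
    · linear_combination hC2 - hB2
    -- The larger root is the right one: by `4C = √2(N + 1)` the quadratic takes the value `6 - N <
    -- 0` at `2√2`, so the smaller root lies below `2√2 < B`.
    · by_contra! hlt
      have h1 : 0 < (B - 2 * √2) * (2 * (5 + 4 * √2 + 3 * √3 + 2 * (√2 * √3)) - B - 2 * √2) :=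
        mul_pos (by linarith) (by nlinarith)
      nlinarith [mul_pos p2 p3]
  · rw [thetaParamA'_four (by norm_num), r12, mul_div_cancel_left₀ _ (by norm_num), h6]
    refine sqrt_two_div_one_sub_eq_add_add (phiRatio_pos (by positivity))
      (phiRatio_lt_one (by positivity)) phiRatio_sqrt_three_sq ?_ ?_
    · grind
    · grind
  · rw [thetaParamA'_four (by norm_num), r28, mul_div_cancel_left₀ _ (by norm_num), h14,
      ← Real.sqrt_mul (by norm_num)]
    have h4 : ∀ y : ℝ, 2 * √y = √(4 * y) := fun y => by rw [Real.sqrt_mul (by norm_num), r4]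
    rw [h4]
    refine sqrt_two_div_one_sub_eq_add_add (phiRatio_pos (by positivity))
      (phiRatio_lt_one (by positivity)) phiRatio_sqrt_seven_sq ?_ ?_
    · grind
    · grind
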